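/- Let $M>0$ and $|a|\le M$, and consider the Kerr metric in Boyer–Lindquist coordinates $(t,r,\theta,\phi)$, $$\mathbf g=-\frac{\Delta-a^2\sin^2\theta}{\Sigma}dt^2-\frac{a\sin^2\theta\,(r^2+a^2-\Delta)}{\Sigma}(dt\otimes d\phi+d\phi\otimes dt)+\frac{\Sigma}{\Delta}dr^2+\Sigma\,d\theta^2+R^2\sin^2\theta\,d\phi^2,$$ with $\Sigma=r^2+a^2\cos^2\theta$, $\Delta=r^2+a^2-2Mr$, $\Sigma R^2=(r^2+a^2)^2-\Delta a^2\sin^2\theta$, $R>0$, in the region $r>M+\sqrt{M^2-a^2}$, $0<\theta<\pi$. Put $\omega_B=\dfrac{2Mar}{\Sigma R^2}$ and $\Omega=\sqrt{\Delta/R^2}$. Let $r_*(r,\theta)$ and $\theta_*(r,\theta)\in(0,\pi)$ be a pair of Israel–Pretorius coordinates, of class $C^2$ on an open set $U$ of values $(r,\theta)$ in this region: $u=\frac12(t-r_*)$ and $\underline u=\frac12(t+r_*)$ solve the eikonal equation $g^{\mu\nu}\partial_\mu w\,\partial_\nu w=0$; $\partial_r r_*>0$; $(\partial_\theta r_*)^2=a^2(\lambda-\sin^2\theta)$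 with $\lambda=\sin^2\theta_*$; $g^{\mu\nu}\partial_\mu r_*\,\partial_\nu\theta_*=0$; and $\partial_\theta\theta_*\neq0$. Put $Q=\sqrt{(r^2+a^2)^2-a^2\lambda\Delta}$. With $\partial_u,\partial_{\underline u},\partial_{\theta_*},\partial_\phi$ the coordinate vector fields of $(u,\underline u,\theta_*,\phi)$, let $$e_3=\frac1\Omega(\partial_u+\omega_B\partial_\phi),\quad e_4=\frac1\Omega(\partial_{\underline u}+\omega_B\partial_\phi),\quad e_\lambda=\frac{\partial_{\theta_*}}{|\partial_{\theta_*}|_{\mathbf g}},\quad e_\phi=\frac1{R\sin\theta}\partial_\phi .$$ With $\mathbf D$ the Levi-Civita connection of $\mathbf g$ and $a,b\in\{\lambda,\phi\}$ as frame indices, let $\chi(e_a,e_b)=\mathbf g(\mathbf D_{e_a}e_4,e_b)$, $\underline\chi(e_a,e_b)=\mathbf g(\mathbf D_{e_a}e_3,e_b)$, $\zeta(e_a)=\frac12\mathbf g(\mathbf D_{e_a}e_4,e_3)$, $\omega=-\frac14\mathbf g(\mathbf D_{e_4}e_3,e_4)$, $\underline\omega=-\frac14\mathbf g(\mathbf D_{e_3}e_4,e_3)$,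 $\mathrm{tr}\chi=\sum_a\chi(e_a,e_a)$, $\mathrm{tr}\underline\chi=\sum_a\underline\chi(e_a,e_a)$. Then at every point with $(r,\theta)\in U$: $$\Omega(\chi+\underline\chi)(e_a,e_b)=e_\lambda(\omega_B)\,R\sin\theta\,(\delta_{b\phi}\delta_{a\lambda}+\delta_{a\phi}\delta_{b\lambda}),$$ $$\zeta(e_a)=\Big(-\frac{QR\sin\theta}{2\Sigma}\,\partial_r\omega_B\Big)\delta_{a\phi},\qquad \omega+\underline\omega=0,\qquad \mathrm{tr}\chi+\mathrm{tr}\underline\chi=0,$$ where $\partial_r\omega_B$ is the derivative of $\omega_B$ as a function of $(r,\theta_*)$, i.e. with respect to $r$ at constant $\theta_*$. -/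

import Mathlib

noncomputable section

namespace Kerr

/-! ### Lorentzian geometry in one chart of a four-dimensional spacetime -/

/-- Points of the coordinate chart, and tangent vectors through their components. -/
abbrev Vec := Fin 4 → ℝ

/-- The partial derivative `∂_i f`. -/
def partialDeriv (i : Fin 4) (f : Vec → ℝ) (x : Vec) : ℝ :=
  fderiv ℝ f x (Pi.single i 1)

/-- The derivative `v(f)` of a function in the direction of the tangent vector `v`. -/
def dirDeriv (v : Vec) (f : Vec → ℝ) (x : Vec) : ℝ :=
  fderiv ℝ f x v

/-- The scalar product `g(v, w)` at the point `x`, for a metric given by its matrix. -/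
def pairing (g : Vec → Matrix (Fin 4) (Fin 4) ℝ) (x v w : Vec) : ℝ :=
  ∑ i, ∑ j, g x i j * v i * w j

/-- The Christoffel symbols `Γ^k_{ij}` of the Levi-Civita connection. -/
def christoffel (g : Vec → Matrix (Fin 4) (Fin 4) ℝ) (x : Vec) (k i j : Fin 4) : ℝ :=
  (1 / 2) * ∑ l, (g x)⁻¹ k l *
    (partialDeriv i (fun y => g y j l) x + partialDeriv j (fun y => g y i l) x
      - partialDeriv l (fun y => g y i j) x)

/-- The Levi-Civita covariant derivative `D_X Y` of vector fields. -/
def covDeriv (g : Vec → Matrix (Fin 4) (Fin 4) ℝ) (X Y : Vec → Vec) (x : Vec) : Vec :=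
  fun k => dirDeriv (X x) (fun y => Y y k) x + ∑ i, ∑ j, christoffel g x k i j * X x i * Y x j

/-- `g^{μν} ∂_μ v ∂_ν w`, the scalar product of the differentials of two functions. -/
def gradPairing (g : Vec → Matrix (Fin 4) (Fin 4) ℝ) (v w : Vec → ℝ) (x : Vec) : ℝ :=
  ∑ i, ∑ j, (g x)⁻¹ i j * partialDeriv i v x * partialDeriv j w x

/-- The coordinate vector field `∂/∂y^i` of a coordinate system `y = (y⁰, y¹, y², y³)`,
that is the vector `v` with `dy^j(v) = δ^j_i`. -/
def coordVec (y : Vec → Vec) (i : Fin 4) (x : Vec) : Vec :=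
  (fderiv ℝ y x).inverse (Pi.single i 1)

/-! ### Connection coefficients of a null frame -/

/-- `χ(X, Y) = g(D_X e₄, Y)`; with `e₃` in place of `e₄` it is `χ̲(X, Y)`. -/
def nullForm (g : Vec → Matrix (Fin 4) (Fin 4) ℝ) (e4 X Y : Vec → Vec) (x : Vec) : ℝ :=
  pairing g x (covDeriv g X e4 x) (Y x)

/-- The torsion `ζ(X) = ½ g(D_X e₄, e₃)`. -/
def torsion (g : Vec → Matrix (Fin 4) (Fin 4) ℝ) (e3 e4 X : Vec → Vec) (x : Vec) : ℝ :=
  (1 / 2) * pairing g x (covDeriv g X e4 x) (e3 x)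

/-- `ω = -¼ g(D_{e₄} e₃, e₄)`; with `e₃` and `e₄` exchanged it is `ω̲`. -/
def nullLapse (g : Vec → Matrix (Fin 4) (Fin 4) ℝ) (e3 e4 : Vec → Vec) (x : Vec) : ℝ :=
  -(1 / 4) * pairing g x (covDeriv g e4 e3 x) (e4 x)

/-! ### The Kerr metric in Boyer-Lindquist coordinates `x = (t, r, θ, φ)` -/

def Sigma (a : ℝ) (x : Vec) : ℝ := x 1 ^ 2 + a ^ 2 * Real.cos (x 2) ^ 2

def Delta (M a : ℝ) (x : Vec) : ℝ := x 1 ^ 2 + a ^ 2 - 2 * M * x 1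

/-- The positive function `R` with `R² = ((r² + a²)² - Δ a² sin² θ) / Σ`. -/
def bigR (M a : ℝ) (x : Vec) : ℝ :=
  √(((x 1 ^ 2 + a ^ 2) ^ 2 - Delta M a x * a ^ 2 * Real.sin (x 2) ^ 2) / Sigma a x)

def omegaB (M a : ℝ) (x : Vec) : ℝ := 2 * M * a * x 1 / (Sigma a x * bigR M a x ^ 2)

/-- The lapse `Ω = √(Δ / R²)` of the double null foliation. -/
def Omega (M a : ℝ) (x : Vec) : ℝ := √(Delta M a x / bigR M a x ^ 2)

/-- The matrix of the Kerr metric. -/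
def metric (M a : ℝ) (x : Vec) : Matrix (Fin 4) (Fin 4) ℝ :=
  let S := Sigma a x
  let D := Delta M a x
  let s := Real.sin (x 2) ^ 2
  let gtt := -((D - a ^ 2 * s) / S)
  let gtp := -(a * s * (x 1 ^ 2 + a ^ 2 - D) / S)
  let gpp := ((x 1 ^ 2 + a ^ 2) ^ 2 - D * a ^ 2 * s) / S * s
  !![gtt, 0, 0, gtp;
     0, S / D, 0, 0;
     0, 0, S, 0;
     gtp, 0, 0, gpp]

/-- The values of `(r, θ)` in the domain of outer communications, axis excluded. -/
def exterior (M a : ℝ) : Set (ℝ × ℝ) :=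
  {p | M + √(M ^ 2 - a ^ 2) < p.1 ∧ p.2 ∈ Set.Ioo 0 Real.pi}

/-! ### Israel-Pretorius coordinates and frame -/

/-- `u = (t - r_*) / 2`. -/
def uFun (rs : ℝ × ℝ → ℝ) (x : Vec) : ℝ := (x 0 - rs (x 1, x 2)) / 2

/-- `u̲ = (t + r_*) / 2`. -/
def ubFun (rs : ℝ × ℝ → ℝ) (x : Vec) : ℝ := (x 0 + rs (x 1, x 2)) / 2

/-- `r_*` and `θ_*`, functions of `(r, θ)`, form a pair of Israel-Pretorius coordinates on `U`:
`u` and `u̲` solve the eikonal equation, `r_*` increases with `r`, the separation parameter of the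
solution is `λ = sin² θ_*`, i.e. `(∂_θ r_*)² = P² = a² (λ - sin² θ)`, and `θ_*` is an angular
coordinate orthogonal to `r_*`. -/
structure IsIsraelPretorius (M a : ℝ) (U : Set (ℝ × ℝ)) (rs ths : ℝ × ℝ → ℝ) : Prop where
  isOpen : IsOpen U
  subset_exterior : U ⊆ exterior M a
  contDiffOn_rs : ContDiffOn ℝ 2 rs U
  contDiffOn_ths : ContDiffOn ℝ 2 ths U
  eikonal_u : ∀ x : Vec, (x 1, x 2) ∈ U → gradPairing (metric M a) (uFun rs) (uFun rs) x = 0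
  eikonal_ub : ∀ x : Vec, (x 1, x 2) ∈ U → gradPairing (metric M a) (ubFun rs) (ubFun rs) x = 0
  rs_increasing : ∀ p ∈ U, 0 < fderiv ℝ rs p (1, 0)
  separation : ∀ p ∈ U,
    fderiv ℝ rs p (0, 1) ^ 2 = a ^ 2 * (Real.sin (ths p) ^ 2 - Real.sin p.2 ^ 2)
  ths_mem : ∀ p ∈ U, ths p ∈ Set.Ioo 0 Real.pi
  orthogonal : ∀ x : Vec, (x 1, x 2) ∈ U →
    gradPairing (metric M a) (fun y => rs (y 1, y 2)) (fun y => ths (y 1, y 2)) x = 0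
  nondegenerate : ∀ p ∈ U, fderiv ℝ ths p (0, 1) ≠ 0

/-- `Q = √((r² + a²)² - a² λ Δ)` with `λ = sin² θ_*`. -/
def bigQ (M a : ℝ) (ths : ℝ × ℝ → ℝ) (x : Vec) : ℝ :=
  √((x 1 ^ 2 + a ^ 2) ^ 2 - a ^ 2 * Real.sin (ths (x 1, x 2)) ^ 2 * Delta M a x)

/-- The coordinates `(u, u̲, θ_*, φ)`. -/
def ipCoord (rs ths : ℝ × ℝ → ℝ) (x : Vec) : Vec :=
  ![uFun rs x, ubFun rs x, ths (x 1, x 2), x 3]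

/-- The coordinates `(t, r, θ_*, φ)`. -/
def radialCoord (ths : ℝ × ℝ → ℝ) (x : Vec) : Vec :=
  ![x 0, x 1, ths (x 1, x 2), x 3]

/-- `∂_r ω_B`, where `ω_B` is a function of `(r, θ_*)`: the derivative with respect to `r` is taken
at constant `θ_*`. -/
def omegaBr (M a : ℝ) (ths : ℝ × ℝ → ℝ) (x : Vec) : ℝ :=
  dirDeriv (coordVec (radialCoord ths) 1 x) (omegaB M a) x

/-- `e₃ = Ω⁻¹ (∂_u + ω_B ∂_φ)`. -/
def e3 (M a : ℝ) (rs ths : ℝ × ℝ → ℝ) (x : Vec) : Vec :=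
  (Omega M a x)⁻¹ •
    (coordVec (ipCoord rs ths) 0 x + omegaB M a x • coordVec (ipCoord rs ths) 3 x)

/-- `e₄ = Ω⁻¹ (∂_u̲ + ω_B ∂_φ)`. -/
def e4 (M a : ℝ) (rs ths : ℝ × ℝ → ℝ) (x : Vec) : Vec :=
  (Omega M a x)⁻¹ •
    (coordVec (ipCoord rs ths) 1 x + omegaB M a x • coordVec (ipCoord rs ths) 3 x)

/-- The frame of the spheres `S(u, u̲)`: `eS 0 = e_λ` is `∂_{θ_*}` normalised to unit length and
`eS 1 = e_φ = (R sin θ)⁻¹ ∂_φ`. -/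
def eS (M a : ℝ) (rs ths : ℝ × ℝ → ℝ) (b : Fin 2) (x : Vec) : Vec :=
  if b = 0 then
    (√(pairing (metric M a) x (coordVec (ipCoord rs ths) 2 x) (coordVec (ipCoord rs ths) 2 x)))⁻¹ •
      coordVec (ipCoord rs ths) 2 x
  else
    (bigR M a x * Real.sin (x 2))⁻¹ • coordVec (ipCoord rs ths) 3 x

/-- `χ(e_a, e_b)`. -/
def chi (M a : ℝ) (rs ths : ℝ × ℝ → ℝ) (b c : Fin 2) (x : Vec) : ℝ :=
  nullForm (metric M a) (e4 M a rs ths) (eS M a rs ths b) (eS M a rs ths c) x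

/-- `χ̲(e_a, e_b)`. -/
def chib (M a : ℝ) (rs ths : ℝ × ℝ → ℝ) (b c : Fin 2) (x : Vec) : ℝ :=
  nullForm (metric M a) (e3 M a rs ths) (eS M a rs ths b) (eS M a rs ths c) x

/-- `ζ(e_a)`. -/
def zeta (M a : ℝ) (rs ths : ℝ × ℝ → ℝ) (b : Fin 2) (x : Vec) : ℝ :=
  torsion (metric M a) (e3 M a rs ths) (e4 M a rs ths) (eS M a rs ths b) x

/-- `ω`. -/
def omega (M a : ℝ) (rs ths : ℝ × ℝ → ℝ) (x : Vec) : ℝ :=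
  nullLapse (metric M a) (e3 M a rs ths) (e4 M a rs ths) x

/-- `ω̲`. -/
def omegab (M a : ℝ) (rs ths : ℝ × ℝ → ℝ) (x : Vec) : ℝ :=
  nullLapse (metric M a) (e4 M a rs ths) (e3 M a rs ths) x

/-- `tr χ`. -/
def trChi (M a : ℝ) (rs ths : ℝ × ℝ → ℝ) (x : Vec) : ℝ := ∑ b, chi M a rs ths b b x

/-- `tr χ̲`. -/
def trChib (M a : ℝ) (rs ths : ℝ × ℝ → ℝ) (x : Vec) : ℝ := ∑ b, chib M a rs ths b b x

/-- The Kronecker symbol of the frame indices. -/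
def kron (b c : Fin 2) : ℝ := if b = c then 1 else 0

end Kerr

end

/-!
Write `T = Ω⁻¹ (∂_t + ω_B ∂_φ)` for the unit normal of the slices `t = const` and `n = Ω grad r_*`,
a unit vector by the eikonal equation. Then `e₃ = T - n` and `e₄ = T + n`, so that everything is
read off from the second fundamental form `k(X, Y) = g(D_X T, Y)` of the slices:
`χ + χ̲ = 2 k`, `ζ(X) = -k(X, n)` and `ω + ω̲ = -k(n, n)`.

Since `∂_t` and `∂_φ` are Killing fields, the symmetric part of `D (∂_t + ω_B ∂_φ)` comes from
`dω_B` alone, and orthogonality to the slices makes this form symmetric on vectors tangent to them.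
Hence `2 Ω k(X, Y) = X(ω_B) g(∂_φ, Y) + Y(ω_B) g(∂_φ, X)`. As `ω_B` is axisymmetric, this couples
only `∂_φ` to directions orthogonal to it: both `n` and `e_λ` are such directions, so `k(n, n)` and
the trace of `k` over the spheres vanish. The formula for `ζ` follows because `n` is `Ω Q / Σ` times
the vector `∂_r` of the coordinates `(r, θ_*)`.
-/

namespace Kerr

open Filter Topology

/-! ### The Levi-Civita connection in a chart -/

section LeviCivita

variable {g : Vec → Matrix (Fin 4) (Fin 4) ℝ} {x : Vec}

theorem fderiv_apply_eq_sum (f : Vec → ℝ) (x v : Vec) :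
    fderiv ℝ f x v = ∑ i, v i * partialDeriv i f x := by
  conv_lhs => rw [← Finset.univ_sum_single v]
  simp_rw [map_sum, partialDeriv, ← smul_eq_mul, ← map_smul, ← Pi.single_smul, smul_eq_mul,
    mul_one]

theorem dirDeriv_comp_apply {Y : Vec → Vec} (hY : DifferentiableAt ℝ Y x) (v : Vec) (k : Fin 4) :
    dirDeriv v (fun y => Y y k) x = fderiv ℝ Y x v k :=
  congrArg (· v) (fderiv_apply hY k)

theorem dirDeriv_eq_zero_of_translation_invariant {f : Vec → ℝ} {v : Vec}
    (hf : ∀ t : ℝ, f (x + t • v) = f x) : dirDeriv v f x = 0 := by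
  by_cases hd : DifferentiableAt ℝ f x
  · rw [dirDeriv, ← hd.lineDeriv_eq_fderiv, lineDeriv, funext hf, deriv_const]
  · rw [dirDeriv, fderiv_zero_of_not_differentiableAt hd, zero_apply]

theorem pairing_eq_toBilin' (g : Vec → Matrix (Fin 4) (Fin 4) ℝ) (x v w : Vec) :
    pairing g x v w = (g x).toBilin' v w := by
  simp only [pairing, Matrix.toBilin'_apply]
  exact Finset.sum_congr rfl fun i _ => Finset.sum_congr rfl fun j _ => by ring

/-- The directional derivative of the metric, `(v(g))_{ij} = v(g_{ij})`. It vanishes exactly when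
the constant field `v` is a Killing field to first order at `x`. -/
noncomputable def metricDeriv (g : Vec → Matrix (Fin 4) (Fin 4) ℝ) (x v : Vec) :
    Matrix (Fin 4) (Fin 4) ℝ :=
  Matrix.of fun i j => dirDeriv v (fun y => g y i j) x

/-- The matrix field `g` is a pseudo-Riemannian metric near `x`, as far as the Levi-Civita
connection at `x` is concerned. -/
structure IsMetricAt (g : Vec → Matrix (Fin 4) (Fin 4) ℝ) (x : Vec) : Prop where
  eventually_isSymm : ∀ᶠ y in 𝓝 x, (g y).IsSymm
  isUnit_det : IsUnit (g x).det
  differentiableAt : ∀ i j, DifferentiableAt ℝ (fun y => g y i j) x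

theorem IsMetricAt.pairing_comm (hg : IsMetricAt g x) (v w : Vec) :
    pairing g x v w = pairing g x w v := by
  simpa only [pairing_eq_toBilin'] using
    (Matrix.isSymm_toBilin'_iff_isSymm.2 hg.eventually_isSymm.self_of_nhds).eq v w

theorem IsMetricAt.metricDeriv_comm (hg : IsMetricAt g x) (u v w : Vec) :
    (metricDeriv g x u).toBilin' v w = (metricDeriv g x u).toBilin' w v := by
  refine (Matrix.isSymm_toBilin'_iff_isSymm.2 (Matrix.IsSymm.ext fun i j => ?_)).eq v w
  have h : (fun y => g y j i) =ᶠ[𝓝 x] fun y => g y i j :=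
    hg.eventually_isSymm.mono fun y hy => hy.apply i j
  simp only [metricDeriv, Matrix.of_apply, dirDeriv, h.fderiv_eq]

/-- The Christoffel symbols of the first kind contracted with `v` and `w`: the covector
`l ↦ Γ_{l,ij} vⁱ wʲ`. -/
noncomputable def christoffelCovector (g : Vec → Matrix (Fin 4) (Fin 4) ℝ) (x v w : Vec) : Vec :=
  fun l => (1 / 2) * ∑ i, ∑ j, (partialDeriv i (fun y => g y j l) x +
    partialDeriv j (fun y => g y i l) x - partialDeriv l (fun y => g y i j) x) * v i * w j

theorem sum_christoffel_mul (g : Vec → Matrix (Fin 4) (Fin 4) ℝ) (x v w : Vec) :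
    (fun k => ∑ i, ∑ j, christoffel g x k i j * v i * w j) =
      (g x)⁻¹.mulVec (christoffelCovector g x v w) := by
  ext k
  simp only [christoffel, christoffelCovector, Matrix.mulVec, dotProduct, Finset.mul_sum,
    Finset.sum_mul]
  calc _ = ∑ i, ∑ l, ∑ j, _ := Finset.sum_congr rfl fun i _ => Finset.sum_comm
    _ = ∑ l, ∑ i, ∑ j, _ := Finset.sum_comm
    _ = _ := Finset.sum_congr rfl fun l _ => Finset.sum_congr rfl fun i _ =>
      Finset.sum_congr rfl fun j _ => by ring

theorem christoffelCovector_dotProduct (g : Vec → Matrix (Fin 4) (Fin 4) ℝ) (x u v w : Vec) :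
    christoffelCovector g x u v ⬝ᵥ w = (1 / 2) * ((metricDeriv g x u).toBilin' v w +
      (metricDeriv g x v).toBilin' u w - (metricDeriv g x w).toBilin' u v) := by
  simp only [dotProduct, christoffelCovector, metricDeriv, Matrix.toBilin'_apply, Matrix.of_apply,
    dirDeriv, fderiv_apply_eq_sum, Fin.sum_univ_four]
  ring

theorem pairing_inv_mulVec (hg : IsMetricAt g x) (f w : Vec) :
    pairing g x ((g x)⁻¹.mulVec f) w = f ⬝ᵥ w := by
  rw [hg.pairing_comm, pairing_eq_toBilin', Matrix.toBilin'_apply', Matrix.mulVec_mulVec,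
    Matrix.mul_nonsing_inv _ hg.isUnit_det, Matrix.one_mulVec, dotProduct_comm]

/-- The bilinear form `(v, w) ↦ g(D_v Y, w)` at `x`. When `Y` is a unit normal field of a
hypersurface, its restriction to tangent vectors is the second fundamental form. -/
noncomputable def covDerivForm (g : Vec → Matrix (Fin 4) (Fin 4) ℝ) (Y : Vec → Vec) (x : Vec) :
    LinearMap.BilinForm ℝ Vec :=
  LinearMap.mk₂ ℝ (fun v w => pairing g x (covDeriv g (fun _ => v) Y x) w)
    (fun v v' w => by
      have h : covDeriv g (fun _ => v + v') Y x =
          covDeriv g (fun _ => v) Y x + covDeriv g (fun _ => v') Y x := by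
        ext k
        simp only [covDeriv, dirDeriv, Pi.add_apply, map_add, mul_add, add_mul,
          Finset.sum_add_distrib]
        ring
      simp only [h, pairing_eq_toBilin', map_add, LinearMap.add_apply])
    (fun c v w => by
      have h : covDeriv g (fun _ => c • v) Y x = c • covDeriv g (fun _ => v) Y x := by
        ext k
        simp only [covDeriv, dirDeriv, Pi.smul_apply, smul_eq_mul, map_smul, mul_add,
          Finset.mul_sum]
        exact congrArg _ (Finset.sum_congr rfl fun i _ => Finset.sum_congr rfl fun j _ => by ring)
      simp only [h, pairing_eq_toBilin', map_smul, LinearMap.smul_apply])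
    (fun v w w' => by simp only [pairing_eq_toBilin', map_add])
    (fun c v w => by simp only [pairing_eq_toBilin', map_smul])

theorem koszul_formula (hg : IsMetricAt g x) {Y : Vec → Vec} (hY : DifferentiableAt ℝ Y x)
    (v w : Vec) :
    covDerivForm g Y x v w = pairing g x (fderiv ℝ Y x v) w +
      (1 / 2) * ((metricDeriv g x v).toBilin' (Y x) w + (metricDeriv g x (Y x)).toBilin' v w
        - (metricDeriv g x w).toBilin' v (Y x)) := by
  have h : covDeriv g (fun _ => v) Y x =
      fderiv ℝ Y x v + (g x)⁻¹.mulVec (christoffelCovector g x v (Y x)) := by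
    rw [← sum_christoffel_mul]
    ext k
    rw [covDeriv, dirDeriv_comp_apply hY, Pi.add_apply]
  rw [covDerivForm, LinearMap.mk₂_apply, h, ← christoffelCovector_dotProduct,
    ← pairing_inv_mulVec hg]
  simp only [pairing_eq_toBilin', map_add, LinearMap.add_apply]

theorem covDerivForm_congr {Y Y' : Vec → Vec} (h : Y =ᶠ[𝓝 x] Y') :
    covDerivForm g Y x = covDerivForm g Y' x := by
  have hk : ∀ k, (fun y => Y y k) =ᶠ[𝓝 x] fun y => Y' y k :=
    fun k => h.mono fun y hy => congrFun hy k
  refine LinearMap.ext fun v => LinearMap.ext fun w => ?_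
  have hcov : covDeriv g (fun _ => v) Y x = covDeriv g (fun _ => v) Y' x := by
    ext k
    simp only [covDeriv, dirDeriv, (hk k).fderiv_eq, h.eq_of_nhds]
  rw [covDerivForm, covDerivForm, LinearMap.mk₂_apply, LinearMap.mk₂_apply, hcov]

theorem covDerivForm_add {Y Z : Vec → Vec} (hY : DifferentiableAt ℝ Y x)
    (hZ : DifferentiableAt ℝ Z x) :
    covDerivForm g (Y + Z) x = covDerivForm g Y x + covDerivForm g Z x := by
  refine LinearMap.ext fun v => LinearMap.ext fun w => ?_
  have h : covDeriv g (fun _ => v) (Y + Z) x =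
      covDeriv g (fun _ => v) Y x + covDeriv g (fun _ => v) Z x := by
    ext k
    rw [Pi.add_apply, covDeriv, dirDeriv_comp_apply (hY.add hZ), fderiv_add hY hZ]
    simp only [covDeriv, dirDeriv_comp_apply hY, dirDeriv_comp_apply hZ, add_apply, Pi.add_apply,
      mul_add, Finset.sum_add_distrib]
    ring
  simp only [covDerivForm, LinearMap.mk₂_apply, LinearMap.add_apply, h, pairing_eq_toBilin',
    map_add]

theorem covDerivForm_smul {f : Vec → ℝ} {Y : Vec → Vec} (hf : DifferentiableAt ℝ f x)
    (hY : DifferentiableAt ℝ Y x) (v w : Vec) :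
    covDerivForm g (f • Y) x v w =
      dirDeriv v f x * pairing g x (Y x) w + f x * covDerivForm g Y x v w := by
  have h : covDeriv g (fun _ => v) (f • Y) x =
      dirDeriv v f x • Y x + f x • covDeriv g (fun _ => v) Y x := by
    ext k
    rw [covDeriv, dirDeriv_comp_apply (hf.smul hY), fderiv_smul hf hY]
    simp only [covDeriv, dirDeriv_comp_apply hY, add_apply, smul_apply,
      ContinuousLinearMap.smulRight_apply, Pi.add_apply, Pi.smul_apply', Pi.smul_apply,
      smul_eq_mul, mul_add, Finset.mul_sum, mul_left_comm _ (f x)]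
    rw [dirDeriv]
    ring
  simp only [covDerivForm, LinearMap.mk₂_apply, h, pairing_eq_toBilin', map_add, map_smul,
    LinearMap.add_apply, LinearMap.smul_apply, smul_eq_mul]

theorem covDerivForm_sub {Y Z : Vec → Vec} (hY : DifferentiableAt ℝ Y x)
    (hZ : DifferentiableAt ℝ Z x) :
    covDerivForm g (Y - Z) x = covDerivForm g Y x - covDerivForm g Z x := by
  have h := covDerivForm_add (g := g) (hY.sub hZ) hZ
  rw [sub_add_cancel] at h
  rw [h]
  exact (add_sub_cancel_right (covDerivForm g (Y - Z) x) (covDerivForm g Z x)).symm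

theorem dirDeriv_pairing (hg : IsMetricAt g x) {Y Z : Vec → Vec} (hY : DifferentiableAt ℝ Y x)
    (hZ : DifferentiableAt ℝ Z x) (v : Vec) :
    dirDeriv v (fun y => pairing g y (Y y) (Z y)) x =
      covDerivForm g Y x v (Z x) + covDerivForm g Z x v (Y x) := by
  have h : HasFDerivAt (fun y => pairing g y (Y y) (Z y))
      (∑ k, ∑ l, ((g x k l * Y x k) • fderiv ℝ (fun y => Z y l) x + Z x l •
        (g x k l • fderiv ℝ (fun y => Y y k) x + Y x k • fderiv ℝ (fun y => g y k l) x))) x :=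
    HasFDerivAt.fun_sum fun k _ => HasFDerivAt.fun_sum fun l _ =>
      ((hg.differentiableAt k l).hasFDerivAt.mul (differentiableAt_pi.1 hY k).hasFDerivAt).mul
        (differentiableAt_pi.1 hZ l).hasFDerivAt
  have product_rule : dirDeriv v (fun y => pairing g y (Y y) (Z y)) x =
      pairing g x (fderiv ℝ Y x v) (Z x) + pairing g x (Y x) (fderiv ℝ Z x v) +
        (metricDeriv g x v).toBilin' (Y x) (Z x) := by
    rw [dirDeriv, h.fderiv]
    simp only [dirDeriv, pairing, metricDeriv, Matrix.toBilin'_apply, Matrix.of_apply,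
      ← dirDeriv_comp_apply hY, ← dirDeriv_comp_apply hZ, ← Finset.sum_add_distrib, sum_apply,
      add_apply, smul_apply, smul_eq_mul]
    exact Finset.sum_congr rfl fun k _ => Finset.sum_congr rfl fun l _ => by ring
  rw [product_rule, koszul_formula hg hY, koszul_formula hg hZ, hg.pairing_comm (Y x),
    hg.metricDeriv_comm _ (Z x) (Y x), hg.metricDeriv_comm (Z x) v (Y x),
    hg.metricDeriv_comm (Y x) v (Z x)]
  ring

theorem covDerivForm_add_eq_zero_of_pairing_eq_const (hg : IsMetricAt g x) {Y Z : Vec → Vec}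
    (hY : DifferentiableAt ℝ Y x) (hZ : DifferentiableAt ℝ Z x) {c : ℝ}
    (h : ∀ᶠ y in 𝓝 x, pairing g y (Y y) (Z y) = c) (v : Vec) :
    covDerivForm g Y x v (Z x) + covDerivForm g Z x v (Y x) = 0 := by
  rw [← dirDeriv_pairing hg hY hZ, dirDeriv, EventuallyEq.fderiv_eq h, fderiv_fun_const,
    Pi.zero_apply, zero_apply]

theorem covDerivForm_const_comm (hg : IsMetricAt g x) (u v w : Vec) :
    covDerivForm g (fun _ => u) x v w = covDerivForm g (fun _ => v) x u w := by
  rw [koszul_formula hg (differentiableAt_const u), koszul_formula hg (differentiableAt_const v),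
    hg.metricDeriv_comm w v u]
  simp only [fderiv_fun_const, Pi.zero_apply, zero_apply]
  ring

theorem covDerivForm_swap_of_metricDeriv_eq_zero (hg : IsMetricAt g x) {K : Vec}
    (hK : metricDeriv g x K = 0) (v w : Vec) :
    covDerivForm g (fun _ => K) x w v = -covDerivForm g (fun _ => K) x v w := by
  rw [koszul_formula hg (differentiableAt_const K), koszul_formula hg (differentiableAt_const K),
    hg.metricDeriv_comm w K v, hg.metricDeriv_comm v K w, hK]
  simp only [fderiv_fun_const, Pi.zero_apply, zero_apply, pairing_eq_toBilin', map_zero,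
    LinearMap.zero_apply]
  ring

theorem covDerivForm_comm_of_pairing_eq_zero (hg : IsMetricAt g x) {T : Vec → Vec}
    (hT : DifferentiableAt ℝ T x) {v w : Vec} (hv : ∀ᶠ y in 𝓝 x, pairing g y (T y) v = 0)
    (hw : ∀ᶠ y in 𝓝 x, pairing g y (T y) w = 0) :
    covDerivForm g T x v w = covDerivForm g T x w v := by
  have leibniz_w := covDerivForm_add_eq_zero_of_pairing_eq_const hg hT
    (differentiableAt_const w) hw v
  have leibniz_v := covDerivForm_add_eq_zero_of_pairing_eq_const hg hT
    (differentiableAt_const v) hv w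
  have torsion_free := covDerivForm_const_comm hg v w (T x)
  linarith

/-- Symmetrising `D T` kills the contributions of the Killing fields `K` and `L`, and `D T` is
already symmetric on vectors orthogonal to `T`. -/
theorem two_mul_covDerivForm_add_smul (hg : IsMetricAt g x) {K L : Vec}
    (hK : metricDeriv g x K = 0) (hL : metricDeriv g x L = 0) {ω : Vec → ℝ}
    (hω : DifferentiableAt ℝ ω x) {v w : Vec}
    (hv : ∀ᶠ y in 𝓝 x, pairing g y (K + ω y • L) v = 0)
    (hw : ∀ᶠ y in 𝓝 x, pairing g y (K + ω y • L) w = 0) :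
    2 * covDerivForm g (fun y => K + ω y • L) x v w =
      dirDeriv v ω x * pairing g x L w + dirDeriv w ω x * pairing g x L v := by
  have hωL : DifferentiableAt ℝ (ω • fun _ : Vec => L) x := hω.smul (differentiableAt_const L)
  have expand : ∀ v w, covDerivForm g (fun y => K + ω y • L) x v w =
      covDerivForm g (fun _ => K) x v w +
        (dirDeriv v ω x * pairing g x L w + ω x * covDerivForm g (fun _ => L) x v w) := by
    intro v w
    rw [← covDerivForm_smul hω (differentiableAt_const L), ← LinearMap.add_apply,
      ← LinearMap.add_apply, ← covDerivForm_add (differentiableAt_const K) hωL]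
    rfl
  have symm := covDerivForm_comm_of_pairing_eq_zero hg ((differentiableAt_const K).add hωL) hv hw
  calc 2 * covDerivForm g (fun y => K + ω y • L) x v w
      = covDerivForm g (fun y => K + ω y • L) x v w +
          covDerivForm g (fun y => K + ω y • L) x w v := by rw [two_mul]; congr 1
    _ = dirDeriv v ω x * pairing g x L w + dirDeriv w ω x * pairing g x L v := by
      rw [expand, expand, covDerivForm_swap_of_metricDeriv_eq_zero hg hK v w,
        covDerivForm_swap_of_metricDeriv_eq_zero hg hL v w]
      ring

theorem coordVec_eq_iff {y : Vec → Vec} (hinj : ∀ v, fderiv ℝ y x v = 0 → v = 0) {i : Fin 4}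
    {v : Vec} : coordVec y i x = v ↔ fderiv ℝ y x v = Pi.single i 1 := by
  have hinv : (fderiv ℝ y x).IsInvertible :=
    ⟨(LinearEquiv.ofInjectiveEndo (fderiv ℝ y x).toLinearMap
      ((injective_iff_map_eq_zero _).2 hinj)).toContinuousLinearEquiv, by ext; simp⟩
  rw [coordVec, hinv.inverse_apply_eq, eq_comm]

end LeviCivita

/-! ### Null frames built from an orthonormal pair -/

section OrthonormalPair

variable {g : Vec → Matrix (Fin 4) (Fin 4) ℝ} {x : Vec} {T n e₃ e₄ : Vec → Vec}

/-- The fields `T` and `n` form an orthonormal pair near `x`, with `T` timelike and `n` spacelike,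
so that `T - n` and `T + n` are null with scalar product `-2`. -/
structure IsOrthonormalPairAt (g : Vec → Matrix (Fin 4) (Fin 4) ℝ) (T n : Vec → Vec) (x : Vec) :
    Prop where
  differentiableAt_timelike : DifferentiableAt ℝ T x
  differentiableAt_spacelike : DifferentiableAt ℝ n x
  timelike : ∀ᶠ y in 𝓝 x, pairing g y (T y) (T y) = -1
  spacelike : ∀ᶠ y in 𝓝 x, pairing g y (n y) (n y) = 1
  orthogonal : ∀ᶠ y in 𝓝 x, pairing g y (T y) (n y) = 0

namespace IsOrthonormalPairAt

theorem nullForm_add_nullForm (h : IsOrthonormalPairAt g T n x) (h₃ : e₃ =ᶠ[𝓝 x] T - n)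
    (h₄ : e₄ =ᶠ[𝓝 x] T + n) (X Y : Vec → Vec) :
    nullForm g e₄ X Y x + nullForm g e₃ X Y x = 2 * covDerivForm g T x (X x) (Y x) := by
  change covDerivForm g e₄ x (X x) (Y x) + covDerivForm g e₃ x (X x) (Y x) = _
  rw [covDerivForm_congr h₃, covDerivForm_congr h₄,
    covDerivForm_add h.differentiableAt_timelike h.differentiableAt_spacelike,
    covDerivForm_sub h.differentiableAt_timelike h.differentiableAt_spacelike]
  simp only [LinearMap.add_apply, LinearMap.sub_apply]
  ring

theorem covDerivForm_timelike_self (h : IsOrthonormalPairAt g T n x) (hg : IsMetricAt g x)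
    (v : Vec) : covDerivForm g T x v (T x) = 0 := by
  linarith [covDerivForm_add_eq_zero_of_pairing_eq_const hg h.differentiableAt_timelike
    h.differentiableAt_timelike h.timelike v]

theorem covDerivForm_spacelike_self (h : IsOrthonormalPairAt g T n x) (hg : IsMetricAt g x)
    (v : Vec) : covDerivForm g n x v (n x) = 0 := by
  linarith [covDerivForm_add_eq_zero_of_pairing_eq_const hg h.differentiableAt_spacelike
    h.differentiableAt_spacelike h.spacelike v]

theorem covDerivForm_spacelike_timelike (h : IsOrthonormalPairAt g T n x) (hg : IsMetricAt g x)
    (v : Vec) : covDerivForm g n x v (T x) = -covDerivForm g T x v (n x) := by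
  linarith [covDerivForm_add_eq_zero_of_pairing_eq_const hg h.differentiableAt_timelike
    h.differentiableAt_spacelike h.orthogonal v]

theorem torsion_eq (h : IsOrthonormalPairAt g T n x) (hg : IsMetricAt g x)
    (h₃ : e₃ =ᶠ[𝓝 x] T - n) (h₄ : e₄ =ᶠ[𝓝 x] T + n) (X : Vec → Vec) :
    torsion g e₃ e₄ X x = -covDerivForm g T x (X x) (n x) := by
  change 1 / 2 * covDerivForm g e₄ x (X x) (e₃ x) = _
  rw [covDerivForm_congr h₄, h₃.eq_of_nhds,
    covDerivForm_add h.differentiableAt_timelike h.differentiableAt_spacelike]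
  simp only [LinearMap.add_apply, Pi.sub_apply, map_sub, h.covDerivForm_timelike_self hg,
    h.covDerivForm_spacelike_self hg, h.covDerivForm_spacelike_timelike hg]
  ring

theorem nullLapse_add_nullLapse (h : IsOrthonormalPairAt g T n x) (hg : IsMetricAt g x)
    (h₃ : e₃ =ᶠ[𝓝 x] T - n) (h₄ : e₄ =ᶠ[𝓝 x] T + n) :
    nullLapse g e₃ e₄ x + nullLapse g e₄ e₃ x = -covDerivForm g T x (n x) (n x) := by
  change -(1 / 4) * covDerivForm g e₃ x (e₄ x) (e₄ x) +
    -(1 / 4) * covDerivForm g e₄ x (e₃ x) (e₃ x) = _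
  rw [covDerivForm_congr h₃, covDerivForm_congr h₄, h₃.eq_of_nhds, h₄.eq_of_nhds,
    covDerivForm_add h.differentiableAt_timelike h.differentiableAt_spacelike,
    covDerivForm_sub h.differentiableAt_timelike h.differentiableAt_spacelike]
  simp only [LinearMap.add_apply, LinearMap.sub_apply, Pi.add_apply, Pi.sub_apply, map_add,
    map_sub, h.covDerivForm_timelike_self hg, h.covDerivForm_spacelike_self hg,
    h.covDerivForm_spacelike_timelike hg]
  ring

end IsOrthonormalPairAt

end OrthonormalPair

/-! ### The Kerr metric in lapse-shift form -/

section KerrMetric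

variable {M a : ℝ} {x : Vec}

theorem isOpen_exterior (M a : ℝ) : IsOpen (exterior M a) :=
  (isOpen_lt continuous_const continuous_fst).inter (isOpen_Ioo.preimage continuous_snd)

theorem eventually_mem_of_isOpen {U : Set (ℝ × ℝ)} (hU : IsOpen U) (hx : (x 1, x 2) ∈ U) :
    ∀ᶠ y : Vec in 𝓝 x, (y 1, y 2) ∈ U :=
  (hU.preimage (by fun_prop : Continuous fun y : Vec => (y 1, y 2))).mem_nhds hx

theorem metric_isSymm (M a : ℝ) (x : Vec) : (metric M a x).IsSymm :=
  Matrix.IsSymm.ext fun i j => by fin_cases i <;> fin_cases j <;> rfl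

theorem metricDeriv_metric_single {i : Fin 4} (h₁ : i ≠ 1) (h₂ : i ≠ 2) :
    metricDeriv (metric M a) x (Pi.single i 1) = 0 := by
  ext j k
  refine dirDeriv_eq_zero_of_translation_invariant fun t => ?_
  simp [metric, Sigma, Delta, h₁.symm, h₂.symm]

theorem dirDeriv_single_omegaB {i : Fin 4} (h₁ : i ≠ 1) (h₂ : i ≠ 2) :
    dirDeriv (Pi.single i 1) (omegaB M a) x = 0 := by
  refine dirDeriv_eq_zero_of_translation_invariant fun t => ?_
  simp [omegaB, bigR, Sigma, Delta, h₁.symm, h₂.symm]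

theorem differentiable_Sigma (a : ℝ) : Differentiable ℝ (Sigma a) := by
  unfold Sigma
  fun_prop

theorem differentiable_Delta (M a : ℝ) : Differentiable ℝ (Delta M a) := by
  unfold Delta
  fun_prop

theorem sin_theta_pos (hx : (x 1, x 2) ∈ exterior M a) : 0 < Real.sin (x 2) :=
  Real.sin_pos_of_pos_of_lt_pi hx.2.1 hx.2.2

variable (ha : |a| ≤ M) (hx : (x 1, x 2) ∈ exterior M a)

include ha hx

theorem radius_pos : 0 < x 1 :=
  (add_nonneg ((abs_nonneg a).trans ha) (Real.sqrt_nonneg _)).trans_lt hx.1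

theorem Sigma_pos : 0 < Sigma a x := by
  have := radius_pos ha hx
  unfold Sigma
  positivity

theorem Delta_pos : 0 < Delta M a x := by
  have hsq : 0 ≤ M ^ 2 - a ^ 2 := sub_nonneg.2 (sq_le_sq.2 (ha.trans (le_abs_self M)))
  have hlt : √(M ^ 2 - a ^ 2) < x 1 - M := lt_sub_iff_add_lt'.2 hx.1
  have := (Real.sqrt_lt hsq ((Real.sqrt_nonneg _).trans hlt.le)).1 hlt
  unfold Delta
  linarith

theorem Sigma_mul_bigR_sq_pos :
    0 < (x 1 ^ 2 + a ^ 2) ^ 2 - Delta M a x * a ^ 2 * Real.sin (x 2) ^ 2 := by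
  have hr := radius_pos ha hx
  have hΔ_le : Delta M a x ≤ x 1 ^ 2 + a ^ 2 :=
    sub_le_self _ (by have := (abs_nonneg a).trans ha; positivity)
  calc 0 < (x 1 ^ 2 + a ^ 2) * x 1 ^ 2 := by positivity
    _ = (x 1 ^ 2 + a ^ 2) ^ 2 - (x 1 ^ 2 + a ^ 2) * a ^ 2 * 1 := by ring
    _ ≤ _ := by gcongr; exact Real.sin_sq_le_one _

theorem bigR_pos : 0 < bigR M a x :=
  Real.sqrt_pos.2 (div_pos (Sigma_mul_bigR_sq_pos ha hx) (Sigma_pos ha hx))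

theorem Sigma_mul_bigR_sq : Sigma a x * bigR M a x ^ 2 =
    (x 1 ^ 2 + a ^ 2) ^ 2 - Delta M a x * a ^ 2 * Real.sin (x 2) ^ 2 := by
  rw [bigR, Real.sq_sqrt (div_pos (Sigma_mul_bigR_sq_pos ha hx) (Sigma_pos ha hx)).le,
    mul_div_cancel₀ _ (Sigma_pos ha hx).ne']

theorem Omega_pos : 0 < Omega M a x :=
  Real.sqrt_pos.2 (div_pos (Delta_pos ha hx) (pow_pos (bigR_pos ha hx) 2))

theorem Omega_sq_mul_bigR_sq : Omega M a x ^ 2 * bigR M a x ^ 2 = Delta M a x := by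
  have hR := pow_pos (bigR_pos ha hx) 2
  rw [Omega, Real.sq_sqrt (div_pos (Delta_pos ha hx) hR).le, div_mul_cancel₀ _ hR.ne']

theorem omegaB_mul_Sigma_mul_bigR_sq :
    omegaB M a x * (Sigma a x * bigR M a x ^ 2) = 2 * M * a * x 1 :=
  div_mul_cancel₀ _ (mul_pos (Sigma_pos ha hx) (pow_pos (bigR_pos ha hx) 2)).ne'

theorem metric_eq_lapse_shift :
    let Ω := Omega M a x
    let ω := omegaB M a x
    let ρ := bigR M a x * Real.sin (x 2)
    metric M a x = !![ω ^ 2 * ρ ^ 2 - Ω ^ 2, 0, 0, -(ω * ρ ^ 2);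
                      0, Sigma a x / Delta M a x, 0, 0;
                      0, 0, Sigma a x, 0;
                      -(ω * ρ ^ 2), 0, 0, ρ ^ 2] := by
  intro Ω ω ρ
  have hS := (Sigma_pos ha hx).ne'
  have hR := (bigR_pos ha hx).ne'
  have hSR := Sigma_mul_bigR_sq ha hx
  have hΩ := Omega_sq_mul_bigR_sq ha hx
  have hω := omegaB_mul_Sigma_mul_bigR_sq ha hx
  have hS_eq : Sigma a x = x 1 ^ 2 + a ^ 2 - a ^ 2 * Real.sin (x 2) ^ 2 := by
    rw [Sigma, Real.cos_sq']
    ring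
  have hΔ_eq : Delta M a x = x 1 ^ 2 + a ^ 2 - 2 * M * x 1 := rfl
  have gφφ : ((x 1 ^ 2 + a ^ 2) ^ 2 - Delta M a x * a ^ 2 * Real.sin (x 2) ^ 2) / Sigma a x *
      Real.sin (x 2) ^ 2 = ρ ^ 2 := by
    rw [← hSR, mul_div_cancel_left₀ _ hS, mul_pow]
  have gtφ : -(a * Real.sin (x 2) ^ 2 * (x 1 ^ 2 + a ^ 2 - Delta M a x) / Sigma a x) =
      -(ω * ρ ^ 2) := by
    rw [neg_inj, div_eq_iff hS]
    linear_combination -Real.sin (x 2) ^ 2 * hω - a * Real.sin (x 2) ^ 2 * hΔ_eq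
  have gtt : -((Delta M a x - a ^ 2 * Real.sin (x 2) ^ 2) / Sigma a x) =
      ω ^ 2 * ρ ^ 2 - Ω ^ 2 := by
    have key : (Delta M a x - a ^ 2 * Real.sin (x 2) ^ 2) * (Sigma a x * bigR M a x ^ 2) =
        Delta M a x * Sigma a x ^ 2 - (2 * M * a * x 1) ^ 2 * Real.sin (x 2) ^ 2 := by
      rw [hSR, hS_eq, hΔ_eq]
      ring
    rw [← neg_div, div_eq_iff hS]
    refine mul_left_cancel₀ (mul_ne_zero hS (pow_ne_zero 2 hR)) ?_
    linear_combination -key + Sigma a x ^ 2 * hΩ -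
      Real.sin (x 2) ^ 2 * (ω * (Sigma a x * bigR M a x ^ 2) + 2 * M * a * x 1) * hω
  simp only [metric, gφφ, gtφ, gtt]

theorem pairing_metric (v w : Vec) : pairing (metric M a) x v w =
    -(Omega M a x ^ 2 * v 0 * w 0) + Sigma a x / Delta M a x * v 1 * w 1 + Sigma a x * v 2 * w 2 +
      (bigR M a x * Real.sin (x 2)) ^ 2 * (v 3 - omegaB M a x * v 0) *
        (w 3 - omegaB M a x * w 0) := by
  simp only [pairing, metric_eq_lapse_shift ha hx, Fin.sum_univ_four, Matrix.of_apply,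
    Matrix.cons_val]
  ring

theorem metric_mul_lapse_shift_inverse :
    let Ω := Omega M a x
    let ω := omegaB M a x
    let ρ := bigR M a x * Real.sin (x 2)
    metric M a x * !![-(Ω ^ 2)⁻¹, 0, 0, -(ω * (Ω ^ 2)⁻¹);
                      0, Delta M a x / Sigma a x, 0, 0;
                      0, 0, (Sigma a x)⁻¹, 0;
                      -(ω * (Ω ^ 2)⁻¹), 0, 0, (ρ ^ 2)⁻¹ - ω ^ 2 * (Ω ^ 2)⁻¹] = 1 := by
  have hS := (Sigma_pos ha hx).ne'
  have hΔ := (Delta_pos ha hx).ne'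
  have hΩ := (Omega_pos ha hx).ne'
  have hR := (bigR_pos ha hx).ne'
  have hsin := (sin_theta_pos hx).ne'
  rw [metric_eq_lapse_shift ha hx]
  ext i j
  fin_cases i <;> fin_cases j <;> simp [Matrix.mul_apply, Fin.sum_univ_four] <;> field_simp <;> ring

theorem gradPairing_metric (v w : Vec → ℝ) : gradPairing (metric M a) v w x =
    -((partialDeriv 0 v x + omegaB M a x * partialDeriv 3 v x) *
      (partialDeriv 0 w x + omegaB M a x * partialDeriv 3 w x) / Omega M a x ^ 2) +
    Delta M a x / Sigma a x * partialDeriv 1 v x * partialDeriv 1 w x +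
    partialDeriv 2 v x * partialDeriv 2 w x / Sigma a x +
    partialDeriv 3 v x * partialDeriv 3 w x / (bigR M a x * Real.sin (x 2)) ^ 2 := by
  simp only [gradPairing, Matrix.inv_eq_right_inv (metric_mul_lapse_shift_inverse ha hx),
    Fin.sum_univ_four, Matrix.of_apply, Matrix.cons_val]
  ring

theorem differentiableAt_bigR : DifferentiableAt ℝ (bigR M a) x := by
  have hS := (Sigma_pos ha hx).ne'
  have dS := differentiable_Sigma a x
  have dΔ := differentiable_Delta M a x
  refine DifferentiableAt.sqrt (by fun_prop (disch := exact hS))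
    (div_pos (Sigma_mul_bigR_sq_pos ha hx) (Sigma_pos ha hx)).ne'

theorem differentiableAt_omegaB : DifferentiableAt ℝ (omegaB M a) x := by
  have h0 := mul_ne_zero (Sigma_pos ha hx).ne' (pow_ne_zero 2 (bigR_pos ha hx).ne')
  have dS := differentiable_Sigma a x
  have dR := differentiableAt_bigR ha hx
  unfold omegaB
  fun_prop (disch := exact h0)

theorem differentiableAt_Omega : DifferentiableAt ℝ (Omega M a) x := by
  have hR := pow_pos (bigR_pos ha hx) 2
  have dΔ := differentiable_Delta M a x
  have dR := differentiableAt_bigR ha hx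
  exact DifferentiableAt.sqrt (by fun_prop (disch := exact hR.ne'))
    (div_pos (Delta_pos ha hx) hR).ne'

theorem differentiableAt_metric (i j : Fin 4) :
    DifferentiableAt ℝ (fun y => metric M a y i j) x := by
  have hS := (Sigma_pos ha hx).ne'
  have hΔ := (Delta_pos ha hx).ne'
  have dS := differentiable_Sigma a x
  have dΔ := differentiable_Delta M a x
  fin_cases i <;> fin_cases j <;>
    simp only [metric, Matrix.of_apply, Matrix.cons_val, Fin.zero_eta, Fin.mk_one,
      Fin.reduceFinMk] <;>
    fun_prop (disch := assumption)

theorem isMetricAt_metric : IsMetricAt (metric M a) x where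
  eventually_isSymm := .of_forall (metric_isSymm M a)
  isUnit_det := Matrix.isUnit_det_of_right_inverse (metric_mul_lapse_shift_inverse ha hx)
  differentiableAt := differentiableAt_metric ha hx

end KerrMetric

/-! ### The second fundamental form of the slices of constant time -/

section TimeSlices

variable {M a : ℝ} {x : Vec}

/-- The velocity field `∂_t + ω_B ∂_φ` of the zero angular momentum observers. -/
noncomputable def zamoField (M a : ℝ) (x : Vec) : Vec :=
  Pi.single 0 1 + omegaB M a x • Pi.single 3 1

/-- The future unit normal `Ω⁻¹ (∂_t + ω_B ∂_φ)` of the slices `t = const`. -/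
noncomputable def unitNormal (M a : ℝ) (x : Vec) : Vec :=
  (Omega M a x)⁻¹ • zamoField M a x

variable (ha : |a| ≤ M) (hx : (x 1, x 2) ∈ exterior M a)

include ha hx

theorem pairing_zamoField (w : Vec) :
    pairing (metric M a) x (zamoField M a x) w = -(Omega M a x ^ 2 * w 0) := by
  rw [pairing_metric ha hx]
  simp [zamoField]

theorem differentiableAt_zamoField : DifferentiableAt ℝ (zamoField M a) x :=
  (differentiableAt_const _).add
    ((differentiableAt_omegaB ha hx).smul (differentiableAt_const _))

theorem two_mul_covDerivForm_zamoField {v w : Vec} (hv : v 0 = 0) (hw : w 0 = 0) :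
    2 * covDerivForm (metric M a) (zamoField M a) x v w =
      (bigR M a x * Real.sin (x 2)) ^ 2 *
        (dirDeriv v (omegaB M a) x * w 3 + dirDeriv w (omegaB M a) x * v 3) := by
  have orthogonal : ∀ u : Vec, u 0 = 0 →
      ∀ᶠ y in 𝓝 x, pairing (metric M a) y (zamoField M a y) u = 0 := fun u hu =>
    (eventually_mem_of_isOpen (isOpen_exterior M a) hx).mono fun y hy => by
      rw [pairing_zamoField ha hy, hu, mul_zero, neg_zero]
  have pairing_phi : ∀ u : Vec, u 0 = 0 → pairing (metric M a) x (Pi.single 3 1) u =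
      (bigR M a x * Real.sin (x 2)) ^ 2 * u 3 := fun u hu => by
    rw [pairing_metric ha hx, hu]
    simp
  have h := two_mul_covDerivForm_add_smul (isMetricAt_metric ha hx)
    (metricDeriv_metric_single (by decide) (by decide))
    (metricDeriv_metric_single (by decide) (by decide))
    (differentiableAt_omegaB ha hx) (orthogonal v hv) (orthogonal w hw)
  rw [pairing_phi v hv, pairing_phi w hw] at h
  exact h.trans (by ring)

theorem differentiableAt_unitNormal : DifferentiableAt ℝ (unitNormal M a) x :=
  ((differentiableAt_Omega ha hx).fun_inv (Omega_pos ha hx).ne').smul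
    (differentiableAt_zamoField ha hx)

theorem pairing_unitNormal (w : Vec) :
    pairing (metric M a) x (unitNormal M a x) w = -(Omega M a x * w 0) := by
  have hΩ := (Omega_pos ha hx).ne'
  rw [unitNormal, pairing_eq_toBilin', map_smul, LinearMap.smul_apply, ← pairing_eq_toBilin',
    pairing_zamoField ha hx, smul_eq_mul]
  field_simp

theorem covDerivForm_unitNormal {v w : Vec} (hv : v 0 = 0) (hw : w 0 = 0) :
    covDerivForm (metric M a) (unitNormal M a) x v w =
      (bigR M a x * Real.sin (x 2)) ^ 2 / (2 * Omega M a x) *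
        (dirDeriv v (omegaB M a) x * w 3 + dirDeriv w (omegaB M a) x * v 3) := by
  have h : unitNormal M a = (fun y => (Omega M a y)⁻¹) • zamoField M a := rfl
  rw [h, covDerivForm_smul ((differentiableAt_Omega ha hx).fun_inv (Omega_pos ha hx).ne')
    (differentiableAt_zamoField ha hx), pairing_zamoField ha hx, hw, mul_zero, neg_zero, mul_zero,
    zero_add]
  have hΩ := (Omega_pos ha hx).ne'
  field_simp
  linear_combination two_mul_covDerivForm_zamoField ha hx hv hw

end TimeSlices

/-! ### Israel-Pretorius coordinates -/

section IsraelPretorius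

variable {M a : ℝ} {U : Set (ℝ × ℝ)} {rs ths f : ℝ × ℝ → ℝ} {x : Vec}

theorem fderiv_prod_apply (f : ℝ × ℝ → ℝ) (p : ℝ × ℝ) (c d : ℝ) :
    fderiv ℝ f p (c, d) = c * fderiv ℝ f p (1, 0) + d * fderiv ℝ f p (0, 1) := by
  have h : ((c, d) : ℝ × ℝ) = c • (1, 0) + d • (0, 1) := by simp
  rw [h, map_add, map_smul, map_smul, smul_eq_mul, smul_eq_mul]

theorem differentiableAt_comp_radius_angle (hf : DifferentiableAt ℝ f (x 1, x 2)) :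
    DifferentiableAt ℝ (fun y : Vec => f (y 1, y 2)) x :=
  DifferentiableAt.comp x (f := fun y : Vec => (y 1, y 2)) hf (by fun_prop)

theorem dirDeriv_comp_radius_angle (hf : DifferentiableAt ℝ f (x 1, x 2)) (v : Vec) :
    dirDeriv v (fun y => f (y 1, y 2)) x = fderiv ℝ f (x 1, x 2) (v 1, v 2) := by
  have h : HasFDerivAt (fun y : Vec => (y 1, y 2))
      ((ContinuousLinearMap.proj (R := ℝ) (φ := fun _ : Fin 4 => ℝ) 1).prod
        (ContinuousLinearMap.proj 2)) x :=
    (hasFDerivAt_apply 1 x).prodMk (hasFDerivAt_apply 2 x)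
  have h' : HasFDerivAt (fun y : Vec => f (y 1, y 2)) _ x :=
    HasFDerivAt.comp x (f := fun y : Vec => (y 1, y 2)) hf.hasFDerivAt h
  rw [dirDeriv, h'.fderiv]
  rfl

theorem dirDeriv_coordinate (v : Vec) (i : Fin 4) : dirDeriv v (fun y => y i) x = v i := by
  rw [dirDeriv, (hasFDerivAt_apply (𝕜 := ℝ) i x).fderiv, ContinuousLinearMap.proj_apply]

theorem differentiableAt_uFun (hrs : DifferentiableAt ℝ rs (x 1, x 2)) :
    DifferentiableAt ℝ (uFun rs) x := by
  unfold uFun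
  fun_prop

theorem differentiableAt_ubFun (hrs : DifferentiableAt ℝ rs (x 1, x 2)) :
    DifferentiableAt ℝ (ubFun rs) x := by
  unfold ubFun
  fun_prop

theorem dirDeriv_uFun (hrs : DifferentiableAt ℝ rs (x 1, x 2)) (v : Vec) :
    dirDeriv v (uFun rs) x = (v 0 - fderiv ℝ rs (x 1, x 2) (v 1, v 2)) / 2 := by
  have h : HasFDerivAt (uFun rs) _ x := ((hasFDerivAt_apply 0 x).sub
    (differentiableAt_comp_radius_angle hrs).hasFDerivAt).mul_const 2⁻¹
  rw [← dirDeriv_comp_radius_angle hrs, dirDeriv, h.fderiv]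
  exact mul_comm _ _

theorem dirDeriv_ubFun (hrs : DifferentiableAt ℝ rs (x 1, x 2)) (v : Vec) :
    dirDeriv v (ubFun rs) x = (v 0 + fderiv ℝ rs (x 1, x 2) (v 1, v 2)) / 2 := by
  have h : HasFDerivAt (ubFun rs) _ x := ((hasFDerivAt_apply 0 x).add
    (differentiableAt_comp_radius_angle hrs).hasFDerivAt).mul_const 2⁻¹
  rw [← dirDeriv_comp_radius_angle hrs, dirDeriv, h.fderiv]
  exact mul_comm _ _

theorem fderiv_ipCoord (hrs : DifferentiableAt ℝ rs (x 1, x 2))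
    (hths : DifferentiableAt ℝ ths (x 1, x 2)) (v : Vec) :
    fderiv ℝ (ipCoord rs ths) x v =
      ![(v 0 - fderiv ℝ rs (x 1, x 2) (v 1, v 2)) / 2,
        (v 0 + fderiv ℝ rs (x 1, x 2) (v 1, v 2)) / 2,
        fderiv ℝ ths (x 1, x 2) (v 1, v 2), v 3] := by
  have h : DifferentiableAt ℝ (ipCoord rs ths) x := differentiableAt_pi.2 fun k => by
    fin_cases k
    exacts [differentiableAt_uFun hrs, differentiableAt_ubFun hrs,
      differentiableAt_comp_radius_angle hths, differentiableAt_apply 3 x]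
  ext k
  rw [← dirDeriv_comp_apply h]
  fin_cases k
  exacts [dirDeriv_uFun hrs v, dirDeriv_ubFun hrs v, dirDeriv_comp_radius_angle hths v,
    dirDeriv_coordinate v 3]

theorem fderiv_radialCoord (hths : DifferentiableAt ℝ ths (x 1, x 2)) (v : Vec) :
    fderiv ℝ (radialCoord ths) x v =
      ![v 0, v 1, fderiv ℝ ths (x 1, x 2) (v 1, v 2), v 3] := by
  have h : DifferentiableAt ℝ (radialCoord ths) x := differentiableAt_pi.2 fun k => by
    fin_cases k
    exacts [differentiableAt_apply 0 x, differentiableAt_apply 1 x,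
      differentiableAt_comp_radius_angle hths, differentiableAt_apply 3 x]
  ext k
  rw [← dirDeriv_comp_apply h]
  fin_cases k
  exacts [dirDeriv_coordinate v 0, dirDeriv_coordinate v 1, dirDeriv_comp_radius_angle hths v,
    dirDeriv_coordinate v 3]

/-- The gradient of `r_*`. -/
noncomputable def gradRs (M a : ℝ) (rs : ℝ × ℝ → ℝ) (x : Vec) : Vec :=
  ![0, Delta M a x / Sigma a x * fderiv ℝ rs (x 1, x 2) (1, 0),
    fderiv ℝ rs (x 1, x 2) (0, 1) / Sigma a x, 0]

/-- The unit normal `Ω grad r_*` of the level sets of `r_*` (within the slices `t = const`). -/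
noncomputable def radialNormal (M a : ℝ) (rs : ℝ × ℝ → ℝ) (x : Vec) : Vec :=
  Omega M a x • gradRs M a rs x

theorem radialNormal_apply_zero : radialNormal M a rs x 0 = 0 := mul_zero _

theorem radialNormal_apply_three : radialNormal M a rs x 3 = 0 := mul_zero _

namespace IsIsraelPretorius

variable (hIP : IsIsraelPretorius M a U rs ths) (ha : |a| ≤ M) (hx : (x 1, x 2) ∈ U)

include hIP hx

theorem differentiableAt_rs : DifferentiableAt ℝ rs (x 1, x 2) :=
  (hIP.contDiffOn_rs.contDiffAt (hIP.isOpen.mem_nhds hx)).differentiableAt two_ne_zero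

theorem differentiableAt_ths : DifferentiableAt ℝ ths (x 1, x 2) :=
  (hIP.contDiffOn_ths.contDiffAt (hIP.isOpen.mem_nhds hx)).differentiableAt two_ne_zero

theorem differentiableAt_fderiv_rs (v : ℝ × ℝ) :
    DifferentiableAt ℝ (fun y : Vec => fderiv ℝ rs (y 1, y 2) v) x := by
  have h : ContDiffAt ℝ 1 (fderiv ℝ rs) (x 1, x 2) :=
    (hIP.contDiffOn_rs.contDiffAt (hIP.isOpen.mem_nhds hx)).fderiv_right (by norm_num)
  exact differentiableAt_comp_radius_angle
    ((h.differentiableAt one_ne_zero).clm_apply (differentiableAt_const v))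

include ha

theorem eikonal : Omega M a x ^ 2 * (Delta M a x * fderiv ℝ rs (x 1, x 2) (1, 0) ^ 2 +
    fderiv ℝ rs (x 1, x 2) (0, 1) ^ 2) = Sigma a x := by
  have hxe := hIP.subset_exterior hx
  have hS := (Sigma_pos ha hxe).ne'
  have hΩ := (Omega_pos ha hxe).ne'
  have partialDeriv_u (i : Fin 4) : partialDeriv i (uFun rs) x =
      ![1 / 2, -fderiv ℝ rs (x 1, x 2) (1, 0) / 2, -fderiv ℝ rs (x 1, x 2) (0, 1) / 2, 0] i := by
    change dirDeriv (Pi.single i 1) (uFun rs) x = _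
    rw [dirDeriv_uFun (hIP.differentiableAt_rs hx), fderiv_prod_apply]
    fin_cases i <;> simp
  have h := hIP.eikonal_u x hx
  simp only [gradPairing_metric ha hxe, partialDeriv_u, Matrix.cons_val] at h
  field_simp at h
  linear_combination h

theorem orthogonal_eq :
    Delta M a x * fderiv ℝ rs (x 1, x 2) (1, 0) * fderiv ℝ ths (x 1, x 2) (1, 0) +
      fderiv ℝ rs (x 1, x 2) (0, 1) * fderiv ℝ ths (x 1, x 2) (0, 1) = 0 := by
  have hxe := hIP.subset_exterior hx
  have hS := (Sigma_pos ha hxe).ne'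
  have partialDeriv_comp {f : ℝ × ℝ → ℝ} (hf : DifferentiableAt ℝ f (x 1, x 2)) (i : Fin 4) :
      partialDeriv i (fun y => f (y 1, y 2)) x =
        ![0, fderiv ℝ f (x 1, x 2) (1, 0), fderiv ℝ f (x 1, x 2) (0, 1), 0] i := by
    change dirDeriv (Pi.single i 1) _ x = _
    rw [dirDeriv_comp_radius_angle hf, fderiv_prod_apply]
    fin_cases i <;> simp
  have h := hIP.orthogonal x hx
  simp only [gradPairing_metric ha hxe, partialDeriv_comp (hIP.differentiableAt_rs hx),
    partialDeriv_comp (hIP.differentiableAt_ths hx), Matrix.cons_val] at h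
  field_simp at h
  linear_combination h

theorem jacobian_ne_zero :
    fderiv ℝ rs (x 1, x 2) (1, 0) * fderiv ℝ ths (x 1, x 2) (0, 1) -
      fderiv ℝ rs (x 1, x 2) (0, 1) * fderiv ℝ ths (x 1, x 2) (1, 0) ≠ 0 := by
  intro h
  refine mul_ne_zero (Sigma_pos ha (hIP.subset_exterior hx)).ne' (hIP.nondegenerate _ hx) ?_
  rw [← hIP.eikonal ha hx]
  linear_combination Omega M a x ^ 2 * (Delta M a x * fderiv ℝ rs (x 1, x 2) (1, 0) * h +
    fderiv ℝ rs (x 1, x 2) (0, 1) * hIP.orthogonal_eq ha hx)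

theorem eq_zero_of_fderiv_ipCoord_eq_zero (v : Vec) (hv : fderiv ℝ (ipCoord rs ths) x v = 0) :
    v = 0 := by
  rw [fderiv_ipCoord (hIP.differentiableAt_rs hx) (hIP.differentiableAt_ths hx)] at hv
  have du_eq : (v 0 - fderiv ℝ rs (x 1, x 2) (v 1, v 2)) / 2 = 0 := congrFun hv 0
  have dub_eq : (v 0 + fderiv ℝ rs (x 1, x 2) (v 1, v 2)) / 2 = 0 := congrFun hv 1
  have dths_eq : fderiv ℝ ths (x 1, x 2) (v 1, v 2) = 0 := congrFun hv 2
  have v_phi : v 3 = 0 := congrFun hv 3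
  have v_t : v 0 = 0 := by linarith
  have drs_eq : fderiv ℝ rs (x 1, x 2) (v 1, v 2) = 0 := by linarith
  rw [fderiv_prod_apply] at drs_eq dths_eq
  have jacobian := hIP.jacobian_ne_zero ha hx
  have v_r : v 1 = 0 := by
    refine (mul_eq_zero.1 ?_).resolve_right jacobian
    linear_combination fderiv ℝ ths (x 1, x 2) (0, 1) * drs_eq -
      fderiv ℝ rs (x 1, x 2) (0, 1) * dths_eq
  have v_theta : v 2 = 0 := by
    refine (mul_eq_zero.1 ?_).resolve_right jacobian
    linear_combination fderiv ℝ rs (x 1, x 2) (1, 0) * dths_eq -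
      fderiv ℝ ths (x 1, x 2) (1, 0) * drs_eq
  ext k
  fin_cases k
  exacts [v_t, v_r, v_theta, v_phi]

theorem coordVec_ipCoord_eq_iff {i : Fin 4} {v : Vec} :
    coordVec (ipCoord rs ths) i x = v ↔
      ![(v 0 - fderiv ℝ rs (x 1, x 2) (v 1, v 2)) / 2,
        (v 0 + fderiv ℝ rs (x 1, x 2) (v 1, v 2)) / 2,
        fderiv ℝ ths (x 1, x 2) (v 1, v 2), v 3] = (Pi.single i 1 : Vec) := by
  rw [coordVec_eq_iff (hIP.eq_zero_of_fderiv_ipCoord_eq_zero ha hx),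
    fderiv_ipCoord (hIP.differentiableAt_rs hx) (hIP.differentiableAt_ths hx)]

theorem coordVec_phi : coordVec (ipCoord rs ths) 3 x = Pi.single 3 1 := by
  rw [hIP.coordVec_ipCoord_eq_iff ha hx, fderiv_prod_apply rs, fderiv_prod_apply ths]
  ext k
  fin_cases k <;> simp

theorem coordVec_thetaStar_zero : coordVec (ipCoord rs ths) 2 x 0 = 0 := by
  generalize hv : coordVec (ipCoord rs ths) 2 x = v
  rw [hIP.coordVec_ipCoord_eq_iff ha hx] at hv
  have du_eq : (v 0 - fderiv ℝ rs (x 1, x 2) (v 1, v 2)) / 2 = 0 := congrFun hv 0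
  have dub_eq : (v 0 + fderiv ℝ rs (x 1, x 2) (v 1, v 2)) / 2 = 0 := congrFun hv 1
  linarith

theorem coordVec_thetaStar_three : coordVec (ipCoord rs ths) 2 x 3 = 0 :=
  congrFun ((hIP.coordVec_ipCoord_eq_iff ha hx).1 rfl) 3

theorem fderiv_rs_gradRs :
    fderiv ℝ rs (x 1, x 2) (gradRs M a rs x 1, gradRs M a rs x 2) = (Omega M a x ^ 2)⁻¹ := by
  have hS := (Sigma_pos ha (hIP.subset_exterior hx)).ne'
  rw [fderiv_prod_apply]
  refine eq_inv_of_mul_eq_one_right ?_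
  simp only [gradRs, Matrix.cons_val]
  field_simp
  linear_combination hIP.eikonal ha hx

theorem fderiv_ths_gradRs :
    fderiv ℝ ths (x 1, x 2) (gradRs M a rs x 1, gradRs M a rs x 2) = 0 := by
  have hS := (Sigma_pos ha (hIP.subset_exterior hx)).ne'
  rw [fderiv_prod_apply]
  simp only [gradRs, Matrix.cons_val]
  field_simp
  linear_combination hIP.orthogonal_eq ha hx

theorem fderiv_ipCoord_add_smul_gradRs (c : ℝ) :
    fderiv ℝ (ipCoord rs ths) x (Pi.single 0 1 + c • gradRs M a rs x) =
      ![(1 - c / Omega M a x ^ 2) / 2, (1 + c / Omega M a x ^ 2) / 2, 0, 0] := by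
  have horizontal_zero : (((Pi.single 0 1 : Vec) 1, (Pi.single 0 1 : Vec) 2) : ℝ × ℝ) = 0 := rfl
  rw [map_add, map_smul, fderiv_ipCoord (hIP.differentiableAt_rs hx) (hIP.differentiableAt_ths hx),
    fderiv_ipCoord (hIP.differentiableAt_rs hx) (hIP.differentiableAt_ths hx),
    hIP.fderiv_rs_gradRs ha hx, hIP.fderiv_ths_gradRs ha hx, horizontal_zero, map_zero, map_zero,
    Pi.single_eq_same, Pi.single_eq_of_ne (by decide)]
  simp only [gradRs, Matrix.cons_val, Matrix.smul_cons, Matrix.smul_empty, Matrix.add_cons,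
    Matrix.head_cons, Matrix.tail_cons, Matrix.empty_add_empty, smul_eq_mul]
  congr! 1 <;> ring_nf

theorem coordVec_u :
    coordVec (ipCoord rs ths) 0 x = Pi.single 0 1 - Omega M a x ^ 2 • gradRs M a rs x := by
  have hΩ := (pow_pos (Omega_pos ha (hIP.subset_exterior hx)) 2).ne'
  rw [coordVec_eq_iff (hIP.eq_zero_of_fderiv_ipCoord_eq_zero ha hx), sub_eq_add_neg, ← neg_smul,
    hIP.fderiv_ipCoord_add_smul_gradRs ha hx, neg_div, div_self hΩ]
  ext k
  fin_cases k <;> norm_num [Pi.single_apply]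

theorem coordVec_ub :
    coordVec (ipCoord rs ths) 1 x = Pi.single 0 1 + Omega M a x ^ 2 • gradRs M a rs x := by
  have hΩ := (pow_pos (Omega_pos ha (hIP.subset_exterior hx)) 2).ne'
  rw [coordVec_eq_iff (hIP.eq_zero_of_fderiv_ipCoord_eq_zero ha hx),
    hIP.fderiv_ipCoord_add_smul_gradRs ha hx, div_self hΩ]
  ext k
  fin_cases k <;> norm_num [Pi.single_apply]

theorem e3_eq : e3 M a rs ths x = unitNormal M a x - radialNormal M a rs x := by
  have hΩ := (Omega_pos ha (hIP.subset_exterior hx)).ne'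
  have hΩ_sq : (Omega M a x)⁻¹ * Omega M a x ^ 2 = Omega M a x := by field_simp
  rw [e3, hIP.coordVec_u ha hx, hIP.coordVec_phi ha hx, unitNormal, radialNormal, zamoField,
    sub_add_eq_add_sub, smul_sub, smul_smul, hΩ_sq]

theorem e4_eq : e4 M a rs ths x = unitNormal M a x + radialNormal M a rs x := by
  have hΩ := (Omega_pos ha (hIP.subset_exterior hx)).ne'
  have hΩ_sq : (Omega M a x)⁻¹ * Omega M a x ^ 2 = Omega M a x := by field_simp
  rw [e4, hIP.coordVec_ub ha hx, hIP.coordVec_phi ha hx, unitNormal, radialNormal, zamoField,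
    add_right_comm, smul_add _ _ (Omega M a x ^ 2 • _), smul_smul, hΩ_sq]

theorem eventuallyEq_e3 : e3 M a rs ths =ᶠ[𝓝 x] unitNormal M a - radialNormal M a rs :=
  (eventually_mem_of_isOpen hIP.isOpen hx).mono fun _ hy => hIP.e3_eq ha hy

theorem eventuallyEq_e4 : e4 M a rs ths =ᶠ[𝓝 x] unitNormal M a + radialNormal M a rs :=
  (eventually_mem_of_isOpen hIP.isOpen hx).mono fun _ hy => hIP.e4_eq ha hy

theorem pairing_radialNormal_self :
    pairing (metric M a) x (radialNormal M a rs x) (radialNormal M a rs x) = 1 := by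
  have hxe := hIP.subset_exterior hx
  have hS := (Sigma_pos ha hxe).ne'
  rw [pairing_metric ha hxe]
  simp only [radialNormal, gradRs, Pi.smul_apply, smul_eq_mul, Matrix.cons_val]
  field_simp
  linear_combination hIP.eikonal ha hx

theorem differentiableAt_radialNormal : DifferentiableAt ℝ (radialNormal M a rs) x := by
  have hxe := hIP.subset_exterior hx
  have hS := (Sigma_pos ha hxe).ne'
  have dS := differentiable_Sigma a x
  have dΔ := differentiable_Delta M a x
  have d_r := hIP.differentiableAt_fderiv_rs hx (1, 0)
  have d_theta := hIP.differentiableAt_fderiv_rs hx (0, 1)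
  refine (differentiableAt_Omega ha hxe).smul (differentiableAt_pi.2 fun k => ?_)
  fin_cases k <;> simp only [gradRs, Matrix.cons_val, Fin.zero_eta, Fin.mk_one, Fin.reduceFinMk] <;>
    fun_prop (disch := assumption)

theorem isOrthonormalPairAt :
    IsOrthonormalPairAt (metric M a) (unitNormal M a) (radialNormal M a rs) x := by
  have near := eventually_mem_of_isOpen hIP.isOpen hx
  refine ⟨differentiableAt_unitNormal ha (hIP.subset_exterior hx),
    hIP.differentiableAt_radialNormal ha hx, near.mono fun y hy => ?_,
    near.mono fun y hy => hIP.pairing_radialNormal_self ha hy, near.mono fun y hy => ?_⟩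
  · have hΩ := (Omega_pos ha (hIP.subset_exterior hy)).ne'
    rw [pairing_unitNormal ha (hIP.subset_exterior hy)]
    simp [unitNormal, zamoField, hΩ]
  · rw [pairing_unitNormal ha (hIP.subset_exterior hy)]
    simp [radialNormal, gradRs]

theorem eS_phi : eS M a rs ths 1 x = (bigR M a x * Real.sin (x 2))⁻¹ • Pi.single 3 1 := by
  rw [eS, if_neg one_ne_zero, hIP.coordVec_phi ha hx]

theorem eS_apply_zero (b : Fin 2) : eS M a rs ths b x 0 = 0 := by
  fin_cases b
  · change (_ * coordVec (ipCoord rs ths) 2 x 0 : ℝ) = 0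
    rw [hIP.coordVec_thetaStar_zero ha hx, mul_zero]
  · simp [hIP.eS_phi ha hx]

theorem eS_apply_three (b : Fin 2) :
    eS M a rs ths b x 3 = kron b 1 * (bigR M a x * Real.sin (x 2))⁻¹ := by
  fin_cases b
  · change (_ * coordVec (ipCoord rs ths) 2 x 3 : ℝ) = _
    simp [hIP.coordVec_thetaStar_three ha hx, kron]
  · simp [hIP.eS_phi ha hx, kron]

theorem dirDeriv_eS_omegaB (b : Fin 2) : dirDeriv (eS M a rs ths b x) (omegaB M a) x =
    kron b 0 * dirDeriv (eS M a rs ths 0 x) (omegaB M a) x := by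
  fin_cases b
  · simp [kron]
  · have h : dirDeriv (Pi.single 3 1) (omegaB M a) x = 0 :=
      dirDeriv_single_omegaB (by decide) (by decide)
    rw [dirDeriv] at h
    simp [dirDeriv, hIP.eS_phi ha hx, kron, h]

theorem Delta_mul_fderiv_rs : Delta M a x * fderiv ℝ rs (x 1, x 2) (1, 0) = bigQ M a ths x := by
  have hxe := hIP.subset_exterior hx
  have hsq : (x 1 ^ 2 + a ^ 2) ^ 2 - a ^ 2 * Real.sin (ths (x 1, x 2)) ^ 2 * Delta M a x =
      (Delta M a x * fderiv ℝ rs (x 1, x 2) (1, 0)) ^ 2 := by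
    linear_combination -(Sigma_mul_bigR_sq ha hxe) - bigR M a x ^ 2 * hIP.eikonal ha hx +
      (Delta M a x * fderiv ℝ rs (x 1, x 2) (1, 0) ^ 2 + fderiv ℝ rs (x 1, x 2) (0, 1) ^ 2) *
        Omega_sq_mul_bigR_sq ha hxe + Delta M a x * hIP.separation _ hx
  rw [bigQ, hsq, Real.sqrt_sq (mul_pos (Delta_pos ha hxe) (hIP.rs_increasing _ hx)).le]

omit ha in
theorem coordVec_radialCoord : coordVec (radialCoord ths) 1 x =
    ![0, 1, -fderiv ℝ ths (x 1, x 2) (1, 0) / fderiv ℝ ths (x 1, x 2) (0, 1), 0] := by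
  have h_theta := hIP.nondegenerate _ hx
  have fderiv_eq := fderiv_radialCoord (hIP.differentiableAt_ths hx)
  have injective (v : Vec) (hv : fderiv ℝ (radialCoord ths) x v = 0) : v = 0 := by
    rw [fderiv_eq, fderiv_prod_apply] at hv
    have v_t : v 0 = 0 := congrFun hv 0
    have v_r : v 1 = 0 := congrFun hv 1
    have dths_eq : v 1 * fderiv ℝ ths (x 1, x 2) (1, 0) +
      v 2 * fderiv ℝ ths (x 1, x 2) (0, 1) = 0 := congrFun hv 2
    have v_phi : v 3 = 0 := congrFun hv 3
    have v_theta : v 2 = 0 := by simpa [v_r, h_theta] using dths_eq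
    ext k
    fin_cases k
    exacts [v_t, v_r, v_theta, v_phi]
  have dths_zero : fderiv ℝ ths (x 1, x 2)
      (1, -fderiv ℝ ths (x 1, x 2) (1, 0) / fderiv ℝ ths (x 1, x 2) (0, 1)) = 0 := by
    rw [fderiv_prod_apply, div_mul_cancel₀ _ h_theta, one_mul, add_neg_cancel]
  rw [coordVec_eq_iff injective, fderiv_eq]
  ext k
  fin_cases k <;> simp [dths_zero]

theorem gradRs_eq_smul_coordVec :
    gradRs M a rs x = (bigQ M a ths x / Sigma a x) • coordVec (radialCoord ths) 1 x := by
  have hS := (Sigma_pos ha (hIP.subset_exterior hx)).ne'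
  have h_theta := hIP.nondegenerate _ hx
  have theta_component : fderiv ℝ rs (x 1, x 2) (0, 1) / Sigma a x =
      bigQ M a ths x / Sigma a x *
        (-fderiv ℝ ths (x 1, x 2) (1, 0) / fderiv ℝ ths (x 1, x 2) (0, 1)) := by
    rw [← hIP.Delta_mul_fderiv_rs ha hx]
    field_simp
    linear_combination hIP.orthogonal_eq ha hx
  have r_component : Delta M a x / Sigma a x * fderiv ℝ rs (x 1, x 2) (1, 0) =
      bigQ M a ths x / Sigma a x := by
    rw [div_mul_eq_mul_div, hIP.Delta_mul_fderiv_rs ha hx]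
  rw [gradRs, hIP.coordVec_radialCoord hx, theta_component, r_component]
  simp only [Matrix.smul_cons, Matrix.smul_empty, smul_eq_mul, mul_zero, mul_one]

theorem dirDeriv_radialNormal_omegaB : dirDeriv (radialNormal M a rs x) (omegaB M a) x =
    Omega M a x * (bigQ M a ths x / Sigma a x * omegaBr M a ths x) := by
  rw [radialNormal, hIP.gradRs_eq_smul_coordVec ha hx, omegaBr]
  simp only [dirDeriv, map_smul, smul_eq_mul]

theorem Omega_mul_chi_add_chib (b c : Fin 2) :
    Omega M a x * (chi M a rs ths b c x + chib M a rs ths b c x) =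
      dirDeriv (eS M a rs ths 0 x) (omegaB M a) x * bigR M a x * Real.sin (x 2) *
        (kron c 1 * kron b 0 + kron b 1 * kron c 0) := by
  have hxe := hIP.subset_exterior hx
  have hΩ := (Omega_pos ha hxe).ne'
  have hR := (bigR_pos ha hxe).ne'
  have hsin := (sin_theta_pos hxe).ne'
  rw [chi, chib, (hIP.isOrthonormalPairAt ha hx).nullForm_add_nullForm (hIP.eventuallyEq_e3 ha hx)
      (hIP.eventuallyEq_e4 ha hx), covDerivForm_unitNormal ha hxe (hIP.eS_apply_zero ha hx b)
      (hIP.eS_apply_zero ha hx c), hIP.eS_apply_three ha hx, hIP.eS_apply_three ha hx,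
    hIP.dirDeriv_eS_omegaB ha hx b, hIP.dirDeriv_eS_omegaB ha hx c]
  field_simp

theorem zeta_eq (b : Fin 2) : zeta M a rs ths b x =
    -(bigQ M a ths x * bigR M a x * Real.sin (x 2) / (2 * Sigma a x)) *
      omegaBr M a ths x * kron b 1 := by
  have hxe := hIP.subset_exterior hx
  have hΩ := (Omega_pos ha hxe).ne'
  have hR := (bigR_pos ha hxe).ne'
  have hsin := (sin_theta_pos hxe).ne'
  have hS := (Sigma_pos ha hxe).ne'
  rw [zeta, (hIP.isOrthonormalPairAt ha hx).torsion_eq (isMetricAt_metric ha hxe)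
      (hIP.eventuallyEq_e3 ha hx) (hIP.eventuallyEq_e4 ha hx),
    covDerivForm_unitNormal ha hxe (hIP.eS_apply_zero ha hx b) radialNormal_apply_zero,
    radialNormal_apply_three, hIP.eS_apply_three ha hx, hIP.dirDeriv_radialNormal_omegaB ha hx]
  field_simp
  ring

theorem omega_add_omegab : omega M a rs ths x + omegab M a rs ths x = 0 := by
  have hxe := hIP.subset_exterior hx
  rw [omega, omegab, (hIP.isOrthonormalPairAt ha hx).nullLapse_add_nullLapse
      (isMetricAt_metric ha hxe) (hIP.eventuallyEq_e3 ha hx) (hIP.eventuallyEq_e4 ha hx),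
    covDerivForm_unitNormal ha hxe radialNormal_apply_zero radialNormal_apply_zero,
    radialNormal_apply_three, mul_zero, add_zero, mul_zero, neg_zero]

theorem trChi_add_trChib : trChi M a rs ths x + trChib M a rs ths x = 0 := by
  rw [trChi, trChib, ← Finset.sum_add_distrib]
  refine Finset.sum_eq_zero fun b _ => ?_
  have kron_mul_kron : kron b 1 * kron b 0 = 0 := by fin_cases b <;> simp [kron]
  have h := hIP.Omega_mul_chi_add_chib ha hx b b
  rw [kron_mul_kron, add_zero, mul_zero] at h
  exact (mul_eq_zero.1 h).resolve_left (Omega_pos ha (hIP.subset_exterior hx)).ne'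

end IsIsraelPretorius

end IsraelPretorius

end Kerr

theorem mainTheorem7 (M a : ℝ) (hM : 0 < M) (ha : |a| ≤ M)
    (U : Set (ℝ × ℝ)) (rs ths : ℝ × ℝ → ℝ) (hIP : Kerr.IsIsraelPretorius M a U rs ths)
    (x : Kerr.Vec) (hx : (x 1, x 2) ∈ U) :
    (∀ b c : Fin 2,
      Kerr.Omega M a x * (Kerr.chi M a rs ths b c x + Kerr.chib M a rs ths b c x) =
        Kerr.dirDeriv (Kerr.eS M a rs ths 0 x) (Kerr.omegaB M a) x
          * Kerr.bigR M a x * Real.sin (x 2)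
          * (Kerr.kron c 1 * Kerr.kron b 0 + Kerr.kron b 1 * Kerr.kron c 0)) ∧
    (∀ b : Fin 2,
      Kerr.zeta M a rs ths b x =
        -(Kerr.bigQ M a ths x * Kerr.bigR M a x * Real.sin (x 2) / (2 * Kerr.Sigma a x))
          * Kerr.omegaBr M a ths x * Kerr.kron b 1) ∧
    Kerr.omega M a rs ths x + Kerr.omegab M a rs ths x = 0 ∧
    Kerr.trChi M a rs ths x + Kerr.trChib M a rs ths x = 0 :=
  ⟨hIP.Omega_mul_chi_add_chib ha hx, hIP.zeta_eq ha hx, hIP.omega_add_omegab ha hx,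
    hIP.trChi_add_trChib ha hx⟩
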